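/- All groups are discrete. Let $\Lambda$ be a non-amenable group without non-abelian free subgroups, let $Z$ be a non-trivial group, and let $\Gamma=\Lambda\wr Z=\big(\bigoplus_{z\in Z}\Lambda_z\big)\rtimes Z$ be the restricted wreath product, where each $\Lambda_z$ is a copy of $\Lambda$ and $Z$ permutes the copies by left translation of the index. View $\Lambda$ as the coordinate subgroup $\Lambda_e\le\Gamma$ at the identity $e\in Z$. Then: 1. $\Lambda_e$ is not amenable. 2. $\Lambda_e$ is not co-amenable in $\Gamma$, i.e. there is no $\Gamma$-invariant mean on $\Gamma/\Lambda_e$. 3. If $Z$ is infinite, then $\Lambda_e$ is unconfined in $\Gamma$: for every finite subset $E\subseteq\Gamma$ not containing the identity there is $\gamma\in\Gamma$ such that $\gamma\Lambda_e\gamma^{-1}\cap E=\varnothing$. Moreover, the C*-algebra $C^*(\lambda_{\Gamma/\Lambda_e})$ generated by the quasi-regular representation of $\Gamma$ on $\ell^2(\Gamma/\Lambda_e)$ is exotic: the canonical map $C^*_{\max}(\Gamma)\to C^*_{\mathrm{red}}(\Gamma)$ from the maximal to the reduced C*-algebra of $\Gamma$ factors through the canonical epimorphism $C^*_{\max}(\Gamma)\to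 C^*(\lambda_{\Gamma/\Lambda_e})$ followed by an epimorphism $C^*(\lambda_{\Gamma/\Lambda_e})\to C^*_{\mathrm{red}}(\Gamma)$, and neither of these two epimorphisms is an isomorphism. 4. If $Z$ has no non-abelian free subgroups, then neither does $\Gamma$. In particular, if $Z$ is infinite and has no non-abelian free subgroups, then $\Gamma$ is a group without non-abelian free subgroups for which $C^*(\lambda_{\Gamma/\Lambda_e})$ is an exotic C*-algebra. -/

import Mathlib

open scoped ENNReal

/-! ### Amenability, co-amenability, unconfined subgroups, free subgroups -/

/-- The `G`-set `X` carries a `G`-invariant mean, i.e. a `G`-invariant finitely additive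
probability measure defined on all subsets of `X`. -/
def HasInvariantMean (G X : Type*) [Group G] [MulAction G X] : Prop :=
  ∃ m : Set X → ℝ, (∀ A, 0 ≤ m A) ∧ m Set.univ = 1 ∧
    (∀ A B, Disjoint A B → m (A ∪ B) = m A + m B) ∧
    ∀ (g : G) (A : Set X), m ((fun x => g • x) '' A) = m A

/-- A (discrete) group is amenable if it has a left-invariant mean. -/
def IsAmenableGroup (G : Type*) [Group G] : Prop := HasInvariantMean G G

/-- The subgroup `H` is co-amenable in `G` if there is a `G`-invariant mean on `G ⧸ H`. -/
def IsCoamenable {G : Type*} [Group G] (H : Subgroup G) : Prop := HasInvariantMean G (G ⧸ H)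

/-- `H` is unconfined in `G`: every finite set avoiding the identity is disjoint from some
conjugate `γ H γ⁻¹`, i.e. the trivial subgroup lies in the Chabauty closure of the
conjugacy class of `H`. -/
def IsUnconfined {G : Type*} [Group G] (H : Subgroup G) : Prop :=
  ∀ E : Finset G, (1 : G) ∉ E → ∃ γ : G, ∀ h ∈ H, γ * h * γ⁻¹ ∉ E

/-- Every free subgroup of `G` is abelian. -/
def HasNoNonabelianFreeSubgroup (G : Type*) [Group G] : Prop :=
  ∀ F : Subgroup G, IsFreeGroup F → ∀ a b : F, a * b = b * a

/-! ### Unitary representations and the C*-algebras they generate -/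

section CStar

universe u v w

/-- Surjective linear isometries `e i` of the Hilbert spaces `H i` act coordinatewise on the
Hilbert direct sum of the `H i`. -/
noncomputable def hilbertSumMap {I : Type w} (H : I → Type v) [∀ i, NormedAddCommGroup (H i)]
    [∀ i, InnerProductSpace ℂ (H i)] (e : ∀ i, H i ≃ₗᵢ[ℂ] H i) :
    lp H 2 ≃ₗᵢ[ℂ] lp H 2 where
  toFun f := ⟨fun i => e i (f i), (lp.memℓp f).mono' fun i => by simp⟩
  invFun f := ⟨fun i => (e i).symm (f i), (lp.memℓp f).mono' fun i => by simp⟩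
  map_add' f g := by
    ext i
    simp
    rfl
  map_smul' c f := by ext i; simp
  left_inv f := by ext i; simp
  right_inv f := by ext i; simp
  norm_map' f := by
    simp [lp.norm_eq_tsum_rpow (p := 2) (by norm_num)]

/-- A permutation of `X` acts on `ℓ²(X)` by `(σ f)(x) = f (σ⁻¹ x)`. -/
noncomputable def permEllTwo {X : Type v} (σ : Equiv.Perm X) :
    lp (fun _ : X => ℂ) 2 ≃ₗᵢ[ℂ] lp (fun _ : X => ℂ) 2 where
  toFun f := ⟨fun x => f (σ.symm x), memℓp_gen
    (((lp.memℓp f).summable (by norm_num)).comp_injective σ.symm.injective)⟩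
  invFun f := ⟨fun x => f (σ x), memℓp_gen
    (((lp.memℓp f).summable (by norm_num)).comp_injective σ.injective)⟩
  map_add' f g := by
    ext i
    simp
    rfl
  map_smul' c f := by ext i; simp
  left_inv f := by ext i; simp
  right_inv f := by ext i; simp
  norm_map' f := by
    rw [lp.norm_eq_tsum_rpow (p := 2) (by norm_num), lp.norm_eq_tsum_rpow (p := 2) (by norm_num)]
    congr 1
    exact σ.symm.tsum_eq (fun x => ‖f x‖ ^ (2 : ℝ≥0∞).toReal)

/-- The permutation representation of `G` on `ℓ²(X)`: `(g f)(x) = f (g⁻¹ x)`. -/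
noncomputable def permRep (G : Type u) (X : Type v) [Group G] [MulAction G X] :
    G →* unitary (lp (fun _ : X => ℂ) 2 →L[ℂ] lp (fun _ : X => ℂ) 2) :=
  Unitary.linearIsometryEquiv.symm.toMonoidHom.comp
    { toFun := fun g => permEllTwo (MulAction.toPerm g)
      map_one' := by ext f x; simp [permEllTwo]
      map_mul' := fun g h => by ext f x; simp [permEllTwo, mul_smul] }

/-- The regular representation `λ_G` on `ℓ²(G)`. -/
noncomputable def regularRep (G : Type u) [Group G] :
    G →* unitary (lp (fun _ : G => ℂ) 2 →L[ℂ] lp (fun _ : G => ℂ) 2) :=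
  permRep G G

/-- The quasi-regular representation `λ_{G/H}` on `ℓ²(G/H)`. -/
noncomputable def quasiRegularRep {G : Type u} [Group G] (H : Subgroup G) :
    G →* unitary (lp (fun _ : G ⧸ H => ℂ) 2 →L[ℂ] lp (fun _ : G ⧸ H => ℂ) 2) :=
  permRep G (G ⧸ H)

/-- A unitary representation of `G` on a Hilbert space (in the universe of `G`). -/
structure UnitaryRep (G : Type u) [Group G] : Type (u + 1) where
  space : Type u
  [normed : NormedAddCommGroup space]
  [inner : InnerProductSpace ℂ space]
  [complete : CompleteSpace space]
  hom : G →* unitary (space →L[ℂ] space)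

attribute [instance] UnitaryRep.normed UnitaryRep.inner UnitaryRep.complete

/-- The universal representation of `G`: the Hilbert direct sum of all unitary representations
of `G`. The Hilbert spaces in the universe of `G` suffice, since they include, up to unitary
equivalence, all those that carry a cyclic representation of `G`. -/
noncomputable def universalRep (G : Type u) [Group G] :
    G →* unitary (lp (fun π : UnitaryRep G => π.space) 2 →L[ℂ]
      lp (fun π : UnitaryRep G => π.space) 2) :=
  Unitary.linearIsometryEquiv.symm.toMonoidHom.comp
    { toFun := fun g => hilbertSumMap (fun π : UnitaryRep G => π.space)
        fun π => Unitary.linearIsometryEquiv (π.hom g)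
      map_one' := by ext f π; simp [hilbertSumMap]
      map_mul' := fun g h => by ext f π; simp [hilbertSumMap] }

/-- The C*-algebra `C*(ρ)` generated by a unitary representation `ρ`: the norm closure of the
star-subalgebra of `B(V)` generated by the operators `ρ g`. -/
noncomputable def cstarOf {G : Type u} [Group G] {V : Type v} [NormedAddCommGroup V]
    [InnerProductSpace ℂ V] [CompleteSpace V] (ρ : G →* unitary (V →L[ℂ] V)) :
    StarSubalgebra ℂ (V →L[ℂ] V) :=
  (StarAlgebra.adjoin ℂ (Set.range fun g => (ρ g : V →L[ℂ] V))).topologicalClosure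

/-- The operator `ρ g`, as an element of `C*(ρ)`. -/
noncomputable def cstarOf.mk {G : Type u} [Group G] {V : Type v} [NormedAddCommGroup V]
    [InnerProductSpace ℂ V] [CompleteSpace V] (ρ : G →* unitary (V →L[ℂ] V)) (g : G) :
    cstarOf ρ :=
  ⟨ρ g, StarSubalgebra.le_topologicalClosure _ (StarAlgebra.subset_adjoin ℂ _ ⟨g, rfl⟩)⟩

/-- The maximal C*-algebra of `G`: the completion of the group algebra for the norm
`a ↦ sup ‖π a‖` over all unitary representations `π`, realised as the C*-algebra generated by
the universal representation. -/
noncomputable abbrev cstarMax (G : Type u) [Group G] :=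
  cstarOf (universalRep G)

/-- The reduced C*-algebra of `G`, generated by the regular representation. -/
noncomputable abbrev cstarRed (G : Type u) [Group G] :=
  cstarOf (regularRep G)

/-- `C*(ρ)` is an exotic C*-algebra of `G`: the canonical map `C*max(G) → C*red(G)` factors as
`q ∘ p` through the canonical epimorphism `p : C*max(G) → C*(ρ)` and an epimorphism
`q : C*(ρ) → C*red(G)`, and neither `p` nor `q` is an isomorphism. (The canonical maps are those
that match the operators of each `g : G`, and these generate the algebras.) -/
def IsExotic {G : Type u} [Group G] {V : Type v} [NormedAddCommGroup V]
    [InnerProductSpace ℂ V] [CompleteSpace V] (ρ : G →* unitary (V →L[ℂ] V)) : Prop :=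
  ∃ (p : cstarMax G →⋆ₐ[ℂ] cstarOf ρ) (q : cstarOf ρ →⋆ₐ[ℂ] cstarRed G),
    (∀ g, p (cstarOf.mk (universalRep G) g) = cstarOf.mk ρ g) ∧
    (∀ g, q (cstarOf.mk ρ g) = cstarOf.mk (regularRep G) g) ∧
    Function.Surjective p ∧ Function.Surjective q ∧
    ¬ Function.Bijective p ∧ ¬ Function.Bijective q

end CStar

/-! ### Restricted wreath products -/

section Wreath

variable (L Z : Type*) [Group L] [Group Z]

/-- The restricted wreath product `(⨁_{z ∈ Z} L) ⋊ Z`, as the subgroup of the unrestricted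
regular wreath product that consists of the elements whose lamp configuration `Z → L` has finite
support. -/
def restrictedWreath : Subgroup (RegularWreathProduct L Z) where
  carrier := {x | (Function.mulSupport x.left).Finite}
  one_mem' := by simp
  mul_mem' {a b} ha hb := by
    refine (ha.union (hb.preimage (f := fun z => a.right⁻¹ * z)
      (mul_right_injective _).injOn)).subset ?_
    exact Function.mulSupport_mul _ _
  inv_mem' {a} ha := by
    refine (ha.preimage (f := fun z => a.right * z) (mul_right_injective _).injOn).subset ?_
    intro z hz
    simpa using hz

open Classical in
/-- The embedding of `L` in the restricted wreath product as the copy of `L` at the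
coordinate `z`. -/
noncomputable def lampHom (z : Z) : L →* restrictedWreath L Z where
  toFun l := ⟨⟨Pi.mulSingle z l, 1⟩,
    (Set.finite_singleton z).subset Pi.mulSupport_mulSingle_subset⟩
  map_one' := by ext <;> simp
  map_mul' a b := by
    apply Subtype.ext
    apply RegularWreathProduct.ext
    · funext x
      simp [Pi.mulSingle_mul]
    · simp

/-- The coordinate subgroup of the restricted wreath product at the identity of `Z`. -/
noncomputable def lampSubgroup : Subgroup (restrictedWreath L Z) := (lampHom L Z 1).range

end Wreath

/-!
A free group with a non-trivial abelian normal subgroup `⟨c⟩` is abelian: conjugation by any `x`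
maps `c` to `c` or `c⁻¹`, so `x ^ 2`, and hence `x`, commutes with `c`. A non-abelian free group
therefore embeds in an extension only if it embeds in the quotient or has a non-abelian free
intersection with the kernel, and finitely many coordinates suffice for two lamp configurations.

Fix `a ≠ 1` in `Z`. Right multiplication by the lamp subgroup changes only the lamp at the cursor,
so the lamp at whichever of `1` and `a` is not the cursor is a function on the cosets. It is
equivariant for the diagonal copy of `L` at the coordinates `1` and `a`, and pushes an invariant
mean on the cosets forward to `L`. Unconfinedness is seen by conjugating with a shift that moves the
lamp off a given finite set.

Canonical surjections `C*(σ) → C*(ρ)` correspond to weak containments `ρ ≺ σ`. If orbit maps into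
`G ⧸ H` can be made injective on any finite set, then `λ_G ≺ λ_{G/H}`; this is unconfinedness. If
`C*max(G) → C*(λ_{G/H})` is injective, then `1 ≺ λ_{G/H}`, which produces an invariant mean on
`G ⧸ H` from almost invariant vectors. If `C*(λ_{G/H}) → C*red(G)` is injective, then
`λ_{G/H} ≺ λ_G`; restricted to `H`, which fixes the basis vector of the trivial coset, this yields
`1 ≺ λ_G|_H`, an `H`-invariant mean on `G`, and the amenability of `H`.
-/

/-! ### Free subgroups -/

theorem commute_of_commute_zpow_left {G : Type*} [Group G] [IsMulTorsionFree G] {a b : G} {n : ℤ}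
    (hn : n ≠ 0) (h : Commute (a ^ n) b) : Commute a b := by
  have hconj : (b * a * b⁻¹) ^ n = a ^ n := by
    rw [conj_zpow, ← h.eq, mul_inv_cancel_right]
  exact (mul_inv_eq_iff_eq_mul.1 (zpow_left_injective hn hconj)).symm

section FreeGroup

variable {F : Type*} [Group F] [IsFreeGroup F]

instance isMulTorsionFree_of_isFreeGroup : IsMulTorsionFree F :=
  (IsFreeGroup.toFreeGroup F).injective.isMulTorsionFree (IsFreeGroup.toFreeGroup F).toMonoidHom

theorem eq_of_commute_freeGroup_of {α : Type*} {s t : α}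
    (h : Commute (FreeGroup.of s) (FreeGroup.of t)) : s = t := by
  classical
  by_contra hst
  have hword := congrArg FreeGroup.toWord h.eq
  simp only [FreeGroup.toWord_mul, FreeGroup.toWord_of, List.cons_append, List.nil_append,
    FreeGroup.reduce.cons, FreeGroup.reduce_nil, Bool.not_true, Bool.true_eq_false, and_false,
    ↓reduceIte, List.cons.injEq, Prod.mk.injEq, hst, false_and] at hword

theorem subsingleton_generators_of_commute (hF : ∀ a b : F, Commute a b) :
    Subsingleton (IsFreeGroup.Generators F) where
  allEq s t := eq_of_commute_freeGroup_of <| by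
    let e := IsFreeGroup.mulEquiv F
    simpa only [e.symm_apply_apply] using (hF (e (.of s)) (e (.of t))).map e.symm

theorem isCyclic_of_isFreeGroup_of_commute (hF : ∀ a b : F, Commute a b) : IsCyclic F := by
  have := subsingleton_generators_of_commute hF
  have : IsCyclic (FreeGroup (IsFreeGroup.Generators F)) := by
    cases isEmpty_or_nonempty (IsFreeGroup.Generators F) with
    | inl _ => infer_instance
    | inr h =>
      have := uniqueOfSubsingleton h.some
      infer_instance
  exact isCyclic_of_surjective (IsFreeGroup.mulEquiv F) (IsFreeGroup.mulEquiv F).surjective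

theorem exists_mem_zpowers_of_commute {a b : F} (h : Commute a b) :
    ∃ c : F, a ∈ Subgroup.zpowers c ∧ b ∈ Subgroup.zpowers c := by
  have hab : ∀ x ∈ ({a, b} : Set F), ∀ y ∈ ({a, b} : Set F), x * y = y * x := by
    rintro x (rfl | rfl) y (rfl | rfl)
    exacts [rfl, h.eq, h.eq.symm, rfl]
  have := Subgroup.isMulCommutative_closure hab
  obtain ⟨c, hc⟩ := (isCyclic_of_isFreeGroup_of_commute
    (F := Subgroup.closure {a, b}) (mul_comm' · ·)).exists_zpow_surjective
  obtain ⟨m, hm⟩ := hc ⟨a, Subgroup.subset_closure (by simp)⟩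
  obtain ⟨n, hn⟩ := hc ⟨b, Subgroup.subset_closure (by simp)⟩
  exact ⟨c, ⟨m, congrArg Subtype.val hm⟩, ⟨n, congrArg Subtype.val hn⟩⟩

theorem commute_of_commute_ne_one {a b c : F} (hc : c ≠ 1) (hac : Commute a c)
    (hbc : Commute b c) : Commute a b := by
  obtain ⟨d, ⟨i, rfl⟩, ⟨j, rfl⟩⟩ := exists_mem_zpowers_of_commute hac
  have hj : j ≠ 0 := fun hj => hc (by simp [hj])
  have hdb : Commute d b := commute_of_commute_zpow_left hj hbc.symm
  exact hdb.zpow_left i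

theorem commute_of_conj_mem_zpowers {x c : F} (hx : x * c * x⁻¹ ∈ Subgroup.zpowers c)
    (hx' : x⁻¹ * c * x ∈ Subgroup.zpowers c) : Commute x c := by
  obtain rfl | hc := eq_or_ne c 1
  · exact Commute.one_right x
  obtain ⟨k, hk : c ^ k = x * c * x⁻¹⟩ := hx
  obtain ⟨l, hl : c ^ l = x⁻¹ * c * x⟩ := hx'
  have hkl : k * l = 1 := by
    have hpow : c ^ (k * l) = c ^ (1 : ℤ) :=
      calc c ^ (k * l) = x * c ^ l * x⁻¹ := by rw [zpow_mul, hk, conj_zpow]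
        _ = c ^ (1 : ℤ) := by rw [hl]; group
    exact injective_zpow_iff_not_isOfFinOrder.2 (not_isOfFinOrder_of_isMulTorsionFree hc) hpow
  have hkk : k * k = 1 := by
    rcases Int.eq_one_or_neg_one_of_mul_eq_one hkl with rfl | rfl <;> norm_num
  have hconj : x ^ (2 : ℤ) * c * (x ^ (2 : ℤ))⁻¹ = c :=
    calc x ^ (2 : ℤ) * c * (x ^ (2 : ℤ))⁻¹ = x * (x * c * x⁻¹) * x⁻¹ := by rw [zpow_two]; group
      _ = c ^ (k * k) := by rw [← hk, ← conj_zpow, ← hk, zpow_mul]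
      _ = c := by rw [hkk, zpow_one]
  exact commute_of_commute_zpow_left two_ne_zero (mul_inv_eq_iff_eq_mul.1 hconj)

theorem commute_of_normal_commute {K : Subgroup F} [K.Normal] (hK : ∀ a b : K, Commute a b)
    (hne : K ≠ ⊥) (a b : F) : Commute a b := by
  obtain ⟨⟨c, hcK⟩, hc⟩ := (isCyclic_of_isFreeGroup_of_commute hK).exists_generator
  have hKc : K ≤ Subgroup.zpowers c := fun x hx => by
    obtain ⟨n, hn⟩ := hc ⟨x, hx⟩
    exact ⟨n, congrArg Subtype.val hn⟩
  have hc1 : c ≠ 1 := by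
    rintro rfl
    exact hne (by simpa using hKc)
  have hcomm : ∀ x : F, Commute x c := fun x =>
    commute_of_conj_mem_zpowers (hKc (‹K.Normal›.conj_mem c hcK x))
      (hKc (‹K.Normal›.conj_mem' c hcK x))
  exact commute_of_commute_ne_one hc1 (hcomm a) (hcomm b)

end FreeGroup

theorem HasNoNonabelianFreeSubgroup.commute {G F : Type*} [Group G] [Group F] [IsFreeGroup F]
    (hG : HasNoNonabelianFreeSubgroup G) {f : F →* G} (hf : Function.Injective f) (a b : F) :
    Commute a b := by
  let e := MonoidHom.ofInjective hf
  have hcomm : Commute (e a) (e b) := hG f.range (.ofMulEquiv e) (e a) (e b)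
  simpa only [e.symm_apply_apply] using hcomm.map e.symm

theorem HasNoNonabelianFreeSubgroup.of_extension {G Q : Type*} [Group G] [Group Q] (f : G →* Q)
    (hQ : HasNoNonabelianFreeSubgroup Q) (hK : HasNoNonabelianFreeSubgroup f.ker) :
    HasNoNonabelianFreeSubgroup G := by
  intro F hF
  by_cases hker : (f.comp F.subtype).ker = ⊥
  · exact hQ.commute ((MonoidHom.ker_eq_bot_iff _).1 hker)
  · have hinj : Function.Injective (F.subtype.subgroupComap f.ker) := fun x y hxy =>
      Subtype.ext (Subtype.ext (congrArg (fun z : f.ker => (z : G)) hxy))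
    exact commute_of_normal_commute (hK.commute hinj) hker

theorem HasNoNonabelianFreeSubgroup.of_closure_pair {G : Type*} [Group G]
    (hG : ∀ a b : G, HasNoNonabelianFreeSubgroup (Subgroup.closure {a, b})) :
    HasNoNonabelianFreeSubgroup G := by
  intro F _ a b
  let C : Subgroup F := Subgroup.closure {a, b}
  have hC : ∀ x : C, (x : G) ∈ Subgroup.closure {(a : G), (b : G)} := by
    rintro ⟨x, hx⟩
    have := Subgroup.mem_map_of_mem F.subtype hx
    simpa [C, MonoidHom.map_closure, Set.image_pair] using this
  let f : C →* Subgroup.closure {(a : G), (b : G)} :=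
    (F.subtype.comp C.subtype).codRestrict _ hC
  have hf : Function.Injective f := (MonoidHom.injective_codRestrict _ _ hC).2
    (F.subtype_injective.comp C.subtype_injective)
  exact congrArg Subtype.val ((hG a b).commute hf
    ⟨a, Subgroup.subset_closure (by simp)⟩ ⟨b, Subgroup.subset_closure (by simp)⟩)

theorem HasNoNonabelianFreeSubgroup.of_forall_mem_finset {G ι : Type*} [Group G] {L : ι → Type*}
    [∀ i, Group (L i)] (hL : ∀ i, HasNoNonabelianFreeSubgroup (L i)) (f : ∀ i, G →* L i)
    (s : Finset ι) (hf : ∀ x, (∀ i ∈ s, f i x = 1) → x = 1) :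
    HasNoNonabelianFreeSubgroup G := by
  classical
  induction s using Finset.induction_on generalizing G with
  | empty =>
    intro F _ a b
    exact Subtype.ext ((hf _ (by simp)).trans (hf _ (by simp)).symm)
  | insert i s _ ih =>
    refine .of_extension (f i) (hL i) (ih (fun j => (f j).comp (f i).ker.subtype) fun x hx => ?_)
    exact Subtype.ext (hf x ((Finset.forall_mem_insert ..).2 ⟨x.2, hx⟩))

theorem HasNoNonabelianFreeSubgroup.of_finite_support {G ι : Type*} [Group G] {L : ι → Type*}
    [∀ i, Group (L i)] (hL : ∀ i, HasNoNonabelianFreeSubgroup (L i)) (f : ∀ i, G →* L i)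
    (hf : ∀ x, (∀ i, f i x = 1) → x = 1) (hfin : ∀ x, {i | f i x ≠ 1}.Finite) :
    HasNoNonabelianFreeSubgroup G := by
  refine .of_closure_pair fun a b => ?_
  let s : Finset ι := ((hfin a).union (hfin b)).toFinset
  refine .of_forall_mem_finset hL (fun i => (f i).comp (Subgroup.subtype _)) s
    fun x hx => Subtype.ext (hf x fun i => ?_)
  by_cases hi : i ∈ s
  · exact hx i hi
  · have hab : f i a = 1 ∧ f i b = 1 := by simpa [s] using hi
    have hle : Subgroup.closure {a, b} ≤ (f i).ker := by
      simpa [Subgroup.closure_le, Set.pair_subset_iff] using hab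
    exact hle x.2

theorem hasNoNonabelianFreeSubgroup_restrictedWreath {L Z : Type*} [Group L] [Group Z]
    (hL : HasNoNonabelianFreeSubgroup L) (hZ : HasNoNonabelianFreeSubgroup Z) :
    HasNoNonabelianFreeSubgroup (restrictedWreath L Z) := by
  let right : restrictedWreath L Z →* Z :=
    RegularWreathProduct.rightHom.comp (restrictedWreath L Z).subtype
  let lamp (z : Z) : right.ker →* L :=
    { toFun x := x.1.1.left z
      map_one' := rfl
      map_mul' x y := by
        have hx : x.1.1.right = 1 := x.2
        simp [hx] }
  refine .of_extension right hZ (.of_finite_support (fun _ => hL) lamp (fun x hx => ?_)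
    fun x => x.1.2)
  exact Subtype.ext (Subtype.ext (RegularWreathProduct.ext (funext hx) x.2))

/-! ### Invariant means and the lamp subgroup -/

theorem HasInvariantMean.map {G K X Y : Type*} [Group G] [Group K] [MulAction G X]
    [MulAction K Y] (h : HasInvariantMean G X) (j : K →* G) (φ : X → Y)
    (hφ : ∀ k x, φ (j k • x) = k • φ x) : HasInvariantMean K Y := by
  obtain ⟨m, hpos, huniv, hadd, hinv⟩ := h
  refine ⟨fun B => m (φ ⁻¹' B), fun B => hpos _, huniv,
    fun B C hBC => hadd _ _ (hBC.preimage φ), fun k B => ?_⟩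
  have hpre : φ ⁻¹' ((fun y => k • y) '' B) = (fun x => j k • x) '' (φ ⁻¹' B) := by
    ext x
    simp only [Set.image_smul, Set.mem_preimage, Set.mem_smul_set_iff_inv_smul_mem, ← map_inv, hφ]
  exact (congrArg m hpre).trans (hinv (j k) _)

theorem IsAmenableGroup.of_mulEquiv {G K : Type*} [Group G] [Group K] (h : IsAmenableGroup G)
    (e : G ≃* K) : IsAmenableGroup K :=
  HasInvariantMean.map h e.symm.toMonoidHom e fun k x => by simp

theorem isAmenableGroup_of_hasInvariantMean {G : Type*} [Group G] {H : Subgroup G}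
    (h : HasInvariantMean H G) : IsAmenableGroup H := by
  obtain ⟨T, hT, -⟩ := H.exists_isComplement_right 1
  exact h.map (MonoidHom.id H) (fun g => (hT.equiv g).1) fun k g =>
    congrArg Prod.fst (hT.equiv_mul_left k g)

section Lamp

variable {L Z : Type*} [Group L] [Group Z]

theorem lampHom_right (z : Z) (l : L) : (lampHom L Z z l).1.right = 1 := rfl

theorem lampHom_left_self (z : Z) (l : L) : (lampHom L Z z l).1.left z = l := by
  classical
  simp [lampHom]

theorem lampHom_left_of_ne {z w : Z} (h : w ≠ z) (l : L) : (lampHom L Z z l).1.left w = 1 := by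
  classical
  simp [lampHom, h]

theorem lampHom_injective (z : Z) : Function.Injective (lampHom L Z z) := fun a b hab => by
  rw [← lampHom_left_self z a, hab, lampHom_left_self]

theorem not_isAmenableGroup_lampSubgroup (hL : ¬ IsAmenableGroup L) :
    ¬ IsAmenableGroup (lampSubgroup L Z) := fun h =>
  hL (h.of_mulEquiv (MonoidHom.ofInjective (lampHom_injective (1 : Z))).symm)

open Classical in
/-- The diagonal copy of `L` in the lamps at the coordinates in the finite set `s`. -/
noncomputable def diagonalLampHom (s : Finset Z) : L →* restrictedWreath L Z where
  toFun l := ⟨⟨fun z => if z ∈ s then l else 1, 1⟩,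
    s.finite_toSet.subset fun z hz => by by_contra hs; simp_all⟩
  map_one' := by ext <;> simp
  map_mul' a b := by
    refine Subtype.ext (RegularWreathProduct.ext (funext fun z => ?_) (by simp))
    by_cases hz : z ∈ s <;> simp [hz]

theorem diagonalLampHom_mul_right (s : Finset Z) (l : L) (γ : restrictedWreath L Z) :
    (diagonalLampHom s l * γ).1.right = γ.1.right := by
  simp [diagonalLampHom]

theorem diagonalLampHom_mul_left {s : Finset Z} {z : Z} (hz : z ∈ s) (l : L)
    (γ : restrictedWreath L Z) : (diagonalLampHom s l * γ).1.left z = l * γ.1.left z := by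
  simp [diagonalLampHom, hz]

open Classical in
/-- The lamp of `γ` at the coordinate `1` or `a` that differs from the cursor `γ.1.right`. -/
noncomputable def lampAwayFromCursor (a : Z) (γ : restrictedWreath L Z) : L :=
  γ.1.left (if γ.1.right = 1 then a else 1)

theorem lampAwayFromCursor_mul_lampHom {a : Z} (ha : a ≠ 1) (γ : restrictedWreath L Z) (l : L) :
    lampAwayFromCursor a (γ * lampHom L Z 1 l) = lampAwayFromCursor a γ := by
  classical
  by_cases h : γ.1.right = 1
  · simp [lampAwayFromCursor, lampHom_right, h, lampHom_left_of_ne ha]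
  · simp [lampAwayFromCursor, lampHom_right, h, lampHom_left_of_ne]

open Classical in
theorem lampAwayFromCursor_diagonalLampHom_mul (a : Z) (l : L) (γ : restrictedWreath L Z) :
    lampAwayFromCursor a (diagonalLampHom {1, a} l * γ) = l * lampAwayFromCursor a γ := by
  rw [lampAwayFromCursor, diagonalLampHom_mul_right, diagonalLampHom_mul_left, lampAwayFromCursor]
  split_ifs <;> simp

theorem not_isCoamenable_lampSubgroup [Nontrivial Z] (hL : ¬ IsAmenableGroup L) :
    ¬ IsCoamenable (lampSubgroup L Z) := fun h => by
  classical
  obtain ⟨a, ha⟩ := exists_ne (1 : Z)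
  let φ : restrictedWreath L Z ⧸ lampSubgroup L Z → L :=
    Quotient.lift (lampAwayFromCursor a) fun γ γ' hγ => by
      obtain ⟨l, hl⟩ := QuotientGroup.leftRel_apply.1 hγ
      rw [← mul_inv_cancel_left γ γ', ← hl, lampAwayFromCursor_mul_lampHom ha]
  refine hL (h.map (diagonalLampHom {1, a}) φ fun l x => ?_)
  induction x using QuotientGroup.induction_on with
  | H γ => exact lampAwayFromCursor_diagonalLampHom_mul a l γ

theorem isUnconfined_lampSubgroup [Infinite Z] : IsUnconfined (lampSubgroup L Z) := by
  intro E hE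
  have hfin : (⋃ x ∈ E, Function.mulSupport x.1.left).Finite :=
    E.finite_toSet.biUnion fun x _ => x.2
  obtain ⟨z, hz⟩ := hfin.exists_notMem
  have hE_left : ∀ x ∈ E, x.1.left z = 1 := by simpa using hz
  let γ : restrictedWreath L Z := ⟨RegularWreathProduct.inl z, by simp [restrictedWreath]⟩
  refine ⟨γ, ?_⟩
  rintro _ ⟨l, rfl⟩ hmem
  have hleft : (γ * lampHom L Z 1 l * γ⁻¹).1.left z = l := by
    simp [γ, lampHom_left_self, lampHom_right]
  obtain rfl : l = 1 := hleft.symm.trans (hE_left _ hmem)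
  exact hE (by simpa using hmem)

end Lamp

/-! ### Star-homomorphisms and generators of C⋆-algebras -/

theorem exists_surjective_starAlgHom_of_graph {R A B : Type*} [CommRing R] [StarRing R]
    [Ring A] [StarRing A] [Algebra R A] [StarModule R A] [Ring B] [StarRing B] [Algebra R B]
    [StarModule R B] {S : StarSubalgebra R (A × B)} (h : ∀ x ∈ S, x.1 = 0 → x.2 = 0) :
    ∃ φ : S.map (StarAlgHom.fst R A B) →⋆ₐ[R] S.map (StarAlgHom.snd R A B),
      Function.Surjective φ ∧
        ∀ x ∈ S, ∀ y : S.map (StarAlgHom.fst R A B), (y : A) = x.1 → (φ y : B) = x.2 := by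
  let p : S →⋆ₐ[R] S.map (StarAlgHom.fst R A B) :=
    ((StarAlgHom.fst R A B).comp S.subtype).codRestrict _ fun x => ⟨x, x.2, rfl⟩
  let q : S →⋆ₐ[R] S.map (StarAlgHom.snd R A B) :=
    ((StarAlgHom.snd R A B).comp S.subtype).codRestrict _ fun x => ⟨x, x.2, rfl⟩
  have hp_inj : Function.Injective p := by
    refine (injective_iff_map_eq_zero p).2 fun x hx => ?_
    have hx_fst : x.1.1 = 0 := congrArg Subtype.val hx
    exact Subtype.ext (Prod.ext hx_fst (h x x.2 hx_fst))
  have hp_surj : Function.Surjective p := by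
    rintro ⟨_, x, hx, rfl⟩
    exact ⟨⟨x, hx⟩, rfl⟩
  have hq_surj : Function.Surjective q := by
    rintro ⟨_, x, hx, rfl⟩
    exact ⟨⟨x, hx⟩, rfl⟩
  let e := StarAlgEquiv.ofBijective p ⟨hp_inj, hp_surj⟩
  refine ⟨q.comp e.symm, hq_surj.comp e.symm.surjective, fun x hx y hy => ?_⟩
  have he : e.symm y = ⟨x, hx⟩ := e.symm_apply_eq.2 (Subtype.ext hy)
  exact congrArg (fun z : S => z.1.2) he

section StarAlgHom

variable {A B : Type*} [CStarAlgebra A] [CStarAlgebra B]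

theorem continuous_starAlgHom (φ : A →⋆ₐ[ℂ] B) : Continuous φ :=
  AddMonoidHomClass.continuous_of_bound φ 1 (by simpa using NonUnitalStarAlgHom.norm_apply_le φ)

-- The functional calculus truncates `a` at height `‖φ a‖` without changing its image.
theorem exists_norm_le_of_isSelfAdjoint (φ : A →⋆ₐ[ℂ] B) {a : A} (ha : IsSelfAdjoint a) :
    ∃ a', φ a' = φ a ∧ ‖a'‖ ≤ ‖φ a‖ := by
  have hφa : IsSelfAdjoint (φ a) := ha.map φ
  set r := ‖φ a‖
  have hr : 0 ≤ r := norm_nonneg _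
  let truncate : ℝ → ℝ := fun x => max (-r) (min x r)
  have hcont : Continuous truncate := by fun_prop
  have hspec : ∀ x ∈ spectrum ℝ (φ a), truncate x = x := fun x hx => by
    have hx : |x| ≤ r := by
      simpa only [cfc_id' ℝ (φ a), Real.norm_eq_abs] using
        norm_apply_le_norm_cfc (fun x : ℝ => x) (φ a) hx
    simp only [truncate, min_eq_left (abs_le.1 hx).2, max_eq_right (abs_le.1 hx).1]
  refine ⟨cfc truncate a, ?_, norm_cfc_le hr fun x _ => ?_⟩
  · rw [StarAlgHomClass.map_cfc φ truncate a hcont.continuousOn (continuous_starAlgHom φ),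
      cfc_congr hspec, cfc_id' ℝ (φ a)]
  · exact abs_le.2 ⟨le_max_left _ _, max_le (neg_le_self hr) (min_le_right _ _)⟩

theorem exists_norm_le_two_mul (φ : A →⋆ₐ[ℂ] B) (a : A) :
    ∃ a', φ a' = φ a ∧ ‖a'‖ ≤ 2 * ‖φ a‖ := by
  obtain ⟨x, hx, hx_norm⟩ := exists_norm_le_of_isSelfAdjoint φ (realPart a).2
  obtain ⟨y, hy, hy_norm⟩ := exists_norm_le_of_isSelfAdjoint φ (imaginaryPart a).2
  have hre : φ (realPart a : A) = (realPart (φ a) : B) := by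
    simp [realPart_apply_coe, map_star, ← Complex.coe_smul]
  have him : φ (imaginaryPart a : A) = (imaginaryPart (φ a) : B) := by
    simp [imaginaryPart_apply_coe, map_star, ← Complex.coe_smul]
  refine ⟨x + Complex.I • y, ?_, ?_⟩
  · rw [map_add, map_smul, hx, hy, hre, him, realPart_add_I_smul_imaginaryPart]
  · calc ‖x + Complex.I • y‖ ≤ ‖x‖ + ‖Complex.I • y‖ := norm_add_le _ _
      _ = ‖x‖ + ‖y‖ := by rw [norm_smul, Complex.norm_I, one_mul]
      _ ≤ ‖φ a‖ + ‖φ a‖ := add_le_add (hx_norm.trans (hre ▸ realPart.norm_le (φ a)))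
          (hy_norm.trans (him ▸ imaginaryPart.norm_le (φ a)))
      _ = 2 * ‖φ a‖ := (two_mul _).symm

theorem isClosed_range_starAlgHom (φ : A →⋆ₐ[ℂ] B) : IsClosed (Set.range φ) := by
  let f : NormedAddGroupHom A B := (φ : A →+ B).mkNormedAddGroupHom 1
    (by simpa using NonUnitalStarAlgHom.norm_apply_le φ)
  have hf : f.SurjectiveOnWith f.range 2 := by
    rintro _ ⟨a, rfl⟩
    exact exists_norm_le_two_mul φ a
  refine isClosed_of_closure_subset fun b hb => ?_
  obtain ⟨a, ha, -⟩ := controlled_closure_of_complete two_pos one_pos hf b hb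
  exact ⟨a, ha⟩

theorem map_topologicalClosure_adjoin (φ : A →⋆ₐ[ℂ] B) (s : Set A) :
    (StarAlgebra.adjoin ℂ s).topologicalClosure.map φ =
      (StarAlgebra.adjoin ℂ (φ '' s)).topologicalClosure := by
  rw [← StarAlgHom.map_adjoin]
  set S := StarAlgebra.adjoin ℂ s
  apply le_antisymm
  · exact image_closure_subset_closure_image (continuous_starAlgHom φ)
  · have hS : IsClosed (S.topologicalClosure : Set A) := S.isClosed_topologicalClosure
    have hclosed : IsClosed (φ '' (S.topologicalClosure : Set A)) := by
      have := isClosed_range_starAlgHom (φ.comp S.topologicalClosure.subtype)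
      rwa [StarAlgHom.coe_comp, Set.range_comp, StarSubalgebra.coe_subtype,
        Subtype.range_coe] at this
    exact closure_minimal (Set.image_mono S.le_topologicalClosure) hclosed

theorem exists_surjective_starAlgHom_adjoin {ι : Type*} {v : ι → A} {w : ι → B}
    (h : ∀ x ∈ StarAlgebra.adjoin ℂ (Set.range fun i => (v i, w i)), ‖x.2‖ ≤ ‖x.1‖) :
    ∃ φ : (StarAlgebra.adjoin ℂ (Set.range v)).topologicalClosure →⋆ₐ[ℂ]
        (StarAlgebra.adjoin ℂ (Set.range w)).topologicalClosure,
      Function.Surjective φ ∧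
        ∀ i (x : (StarAlgebra.adjoin ℂ (Set.range v)).topologicalClosure),
          (x : A) = v i → (φ x : B) = w i := by
  let S := (StarAlgebra.adjoin ℂ (Set.range fun i => (v i, w i))).topologicalClosure
  have hS : ∀ x ∈ S, ‖x.2‖ ≤ ‖x.1‖ := fun x hx =>
    closure_minimal (t := {x : A × B | ‖x.2‖ ≤ ‖x.1‖}) h
      (isClosed_le (by fun_prop) (by fun_prop)) hx
  have hfst : S.map (StarAlgHom.fst ℂ A B) =
      (StarAlgebra.adjoin ℂ (Set.range v)).topologicalClosure := by
    rw [map_topologicalClosure_adjoin, ← Set.range_comp]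
    rfl
  have hsnd : S.map (StarAlgHom.snd ℂ A B) =
      (StarAlgebra.adjoin ℂ (Set.range w)).topologicalClosure := by
    rw [map_topologicalClosure_adjoin, ← Set.range_comp]
    rfl
  rw [← hfst, ← hsnd]
  obtain ⟨φ, hφ_surj, hφ⟩ := exists_surjective_starAlgHom_of_graph (S := S) fun x hx hx_fst => by
    simpa [hx_fst] using hS x hx
  exact ⟨φ, hφ_surj, fun i x hx => hφ (v i, w i)
    (StarSubalgebra.le_topologicalClosure _ (StarAlgebra.subset_adjoin ℂ _ ⟨i, rfl⟩)) x hx⟩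

end StarAlgHom

/-! ### Weak containment -/

section WeakContainment

variable {G K U V W : Type*} [Group G] [Group K]
  [NormedAddCommGroup U] [InnerProductSpace ℂ U] [CompleteSpace U]
  [NormedAddCommGroup V] [InnerProductSpace ℂ V] [CompleteSpace V]
  [NormedAddCommGroup W] [InnerProductSpace ℂ W] [CompleteSpace W]

/-- The extension of a unitary representation of `G` to the group algebra `ℂ[G]`. -/
noncomputable def integratedForm (ρ : G →* unitary (V →L[ℂ] V)) :
    MonoidAlgebra ℂ G →ₐ[ℂ] (V →L[ℂ] V) :=
  MonoidAlgebra.lift ℂ (V →L[ℂ] V) G ((unitary (V →L[ℂ] V)).subtype.comp ρ)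

/-- The weak containment `ρ ≺ σ` of unitary representations, expressed by the norms of the
operators of the group algebra. -/
def WeaklyContained (ρ : G →* unitary (V →L[ℂ] V)) (σ : G →* unitary (W →L[ℂ] W)) : Prop :=
  ∀ c, ‖integratedForm ρ c‖ ≤ ‖integratedForm σ c‖

theorem integratedForm_of (ρ : G →* unitary (V →L[ℂ] V)) (g : G) :
    integratedForm ρ (MonoidAlgebra.of ℂ G g) = ρ g :=
  MonoidAlgebra.lift_of ..

theorem WeaklyContained.trans {ρ : G →* unitary (U →L[ℂ] U)} {σ : G →* unitary (V →L[ℂ] V)}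
    {τ : G →* unitary (W →L[ℂ] W)} (hρσ : WeaklyContained ρ σ) (hστ : WeaklyContained σ τ) :
    WeaklyContained ρ τ := fun c => (hρσ c).trans (hστ c)

theorem integratedForm_comp (ρ : G →* unitary (V →L[ℂ] V)) (f : K →* G) (c : MonoidAlgebra ℂ K) :
    integratedForm (ρ.comp f) c = integratedForm ρ (MonoidAlgebra.mapDomainAlgHom ℂ ℂ f c) := by
  induction c using MonoidAlgebra.induction_on with
  | of k => simp [integratedForm]
  | add c d hc hd => simp only [map_add, hc, hd]
  | smul a c hc => simp only [map_smul, hc]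

theorem WeaklyContained.comp {ρ : G →* unitary (V →L[ℂ] V)} {σ : G →* unitary (W →L[ℂ] W)}
    (h : WeaklyContained ρ σ) (f : K →* G) : WeaklyContained (ρ.comp f) (σ.comp f) := fun c => by
  simpa only [integratedForm_comp] using h _

theorem integratedForm_intertwine {ρ : G →* unitary (V →L[ℂ] V)} {σ : G →* unitary (W →L[ℂ] W)}
    {T : V →L[ℂ] W} (hT : ∀ g v, T ((ρ g : V →L[ℂ] V) v) = (σ g : W →L[ℂ] W) (T v))
    (c : MonoidAlgebra ℂ G) (v : V) : T (integratedForm ρ c v) = integratedForm σ c (T v) := by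
  induction c using MonoidAlgebra.induction_on with
  | of g => simpa only [integratedForm_of] using hT g v
  | add c d hc hd => simp only [map_add, add_apply, hc, hd]
  | smul a c hc => simp only [map_smul, smul_apply, hc]

theorem WeaklyContained.of_linearIsometry {ρ : G →* unitary (V →L[ℂ] V)}
    {σ : G →* unitary (W →L[ℂ] W)} (T : V →ₗᵢ[ℂ] W)
    (hT : ∀ g v, T ((ρ g : V →L[ℂ] V) v) = (σ g : W →L[ℂ] W) (T v)) : WeaklyContained ρ σ :=
  fun c => ContinuousLinearMap.opNorm_le_bound _ (norm_nonneg _) fun v => by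
    calc ‖integratedForm ρ c v‖ = ‖T (integratedForm ρ c v)‖ := (T.norm_map _).symm
      _ = ‖integratedForm σ c (T v)‖ :=
        congrArg norm (integratedForm_intertwine (T := T.toContinuousLinearMap) hT c v)
      _ ≤ ‖integratedForm σ c‖ * ‖T v‖ := (integratedForm σ c).le_opNorm _
      _ = ‖integratedForm σ c‖ * ‖v‖ := by rw [T.norm_map]

theorem weaklyContained_one_of_fixed {ρ : G →* unitary (V →L[ℂ] V)} {ξ : V} (hξ : ‖ξ‖ = 1)
    (hfixed : ∀ g, (ρ g : V →L[ℂ] V) ξ = ξ) :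
    WeaklyContained (1 : G →* unitary (ℂ →L[ℂ] ℂ)) ρ :=
  .of_linearIsometry (LinearIsometry.toSpanSingleton ℂ V hξ) fun g z => by simp [hfixed]

theorem weaklyContained_of_dense_orbit {ρ : G →* unitary (V →L[ℂ] V)}
    {σ : G →* unitary (W →L[ℂ] W)} {ξ : V}
    (hξ : DenseRange fun b => integratedForm ρ b ξ)
    (h : ∀ F : Finset G, ∃ η : W, ∀ b : MonoidAlgebra ℂ G, b.coeff.support ⊆ F →
      ‖integratedForm ρ b ξ‖ = ‖integratedForm σ b η‖) : WeaklyContained ρ σ := by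
  classical
  intro c
  refine ContinuousLinearMap.opNorm_le_bound _ (norm_nonneg _) fun v => ?_
  refine hξ.induction_on v (isClosed_le (by fun_prop) (by fun_prop)) fun b => ?_
  obtain ⟨η, hη⟩ := h (b.coeff.support ∪ (c * b).coeff.support)
  calc ‖integratedForm ρ c (integratedForm ρ b ξ)‖ = ‖integratedForm ρ (c * b) ξ‖ := by
        rw [map_mul]; rfl
    _ = ‖integratedForm σ c (integratedForm σ b η)‖ := by
        rw [hη _ Finset.subset_union_right, map_mul]; rfl
    _ ≤ ‖integratedForm σ c‖ * ‖integratedForm σ b η‖ := (integratedForm σ c).le_opNorm _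
    _ = ‖integratedForm σ c‖ * ‖integratedForm ρ b ξ‖ := by
        rw [hη _ Finset.subset_union_left]

theorem adjoin_range_le_range_lift {R A : Type*} [CommSemiring R] [StarRing R] [Semiring A]
    [StarRing A] [Algebra R A] [StarModule R A] {ρ : G →* A} (hρ : ∀ g, star (ρ g) = ρ g⁻¹) :
    (StarAlgebra.adjoin R (Set.range ρ)).toSubalgebra ≤ (MonoidAlgebra.lift R A G ρ).range := by
  rw [StarAlgebra.adjoin_toSubalgebra, Algebra.adjoin_le_iff, Set.union_subset_iff]
  constructor
  · rintro _ ⟨g, rfl⟩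
    exact ⟨MonoidAlgebra.of R G g, MonoidAlgebra.lift_of ..⟩
  · rintro a ⟨g, hg⟩
    refine ⟨MonoidAlgebra.of R G g⁻¹, (MonoidAlgebra.lift_of ..).trans ?_⟩
    rw [← hρ, show ρ g = star a from hg, star_star]

theorem WeaklyContained.exists_surjective {ρ : G →* unitary (V →L[ℂ] V)}
    {σ : G →* unitary (W →L[ℂ] W)} (h : WeaklyContained ρ σ) :
    ∃ φ : cstarOf σ →⋆ₐ[ℂ] cstarOf ρ,
      (∀ g, φ (cstarOf.mk σ g) = cstarOf.mk ρ g) ∧ Function.Surjective φ := by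
  let τ : G →* (W →L[ℂ] W) × (V →L[ℂ] V) :=
    ((unitary _).subtype.comp σ).prod ((unitary _).subtype.comp ρ)
  have hτ_star (g : G) : star (τ g) = τ g⁻¹ :=
    (Prod.ext (congrArg Subtype.val (map_inv σ g)) (congrArg Subtype.val (map_inv ρ g))).symm
  have hτ (c : MonoidAlgebra ℂ G) :
      MonoidAlgebra.lift ℂ _ G τ c = (integratedForm σ c, integratedForm ρ c) := by
    induction c using MonoidAlgebra.induction_on with
    | of g => simp only [MonoidAlgebra.lift_of, integratedForm_of]; rfl
    | add c d hc hd => simp only [map_add, hc, hd, Prod.mk_add_mk]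
    | smul a c hc => simp only [map_smul, hc, Prod.smul_mk]
  obtain ⟨φ, hφ_surj, hφ⟩ := exists_surjective_starAlgHom_adjoin (v := fun g => (σ g : W →L[ℂ] W))
    (w := fun g => (ρ g : V →L[ℂ] V)) fun x hx => by
      obtain ⟨c, hc⟩ := adjoin_range_le_range_lift hτ_star hx
      rw [show x = _ from hc.symm.trans (hτ c)]
      exact h c
  exact ⟨φ, fun g => Subtype.ext (hφ g _ rfl), hφ_surj⟩

theorem weaklyContained_of_injective {ρ : G →* unitary (V →L[ℂ] V)}
    {σ : G →* unitary (W →L[ℂ] W)} {φ : cstarOf σ →⋆ₐ[ℂ] cstarOf ρ}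
    (hφ : ∀ g, φ (cstarOf.mk σ g) = cstarOf.mk ρ g) (hinj : Function.Injective φ) :
    WeaklyContained σ ρ := by
  intro c
  obtain ⟨x, hxσ, hxρ⟩ : ∃ x : cstarOf σ,
      (x : W →L[ℂ] W) = integratedForm σ c ∧ (φ x : V →L[ℂ] V) = integratedForm ρ c := by
    induction c using MonoidAlgebra.induction_on with
    | of g =>
      rw [integratedForm_of, integratedForm_of]
      exact ⟨cstarOf.mk σ g, rfl, congrArg Subtype.val (hφ g)⟩
    | add c d hc hd =>
      obtain ⟨⟨x, hxσ, hxρ⟩, y, hyσ, hyρ⟩ := And.intro hc hd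
      exact ⟨x + y, by simp [hxσ, hyσ], by simp [hxρ, hyρ]⟩
    | smul a c hc =>
      obtain ⟨x, hxσ, hxρ⟩ := hc
      exact ⟨a • x, by simp [hxσ], by simp [hxρ]⟩
  have hσ : IsClosed (cstarOf σ : Set (W →L[ℂ] W)) := StarSubalgebra.isClosed_topologicalClosure _
  have hρ : IsClosed (cstarOf ρ : Set (V →L[ℂ] V)) := StarSubalgebra.isClosed_topologicalClosure _
  rw [← hxσ, ← hxρ]
  exact (NonUnitalStarAlgHom.norm_map φ hinj x).ge

end WeakContainment

/-! ### Almost invariant vectors and invariant means -/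

section AlmostInvariant

variable {G V : Type*} [Group G] [NormedAddCommGroup V] [InnerProductSpace ℂ V]

theorem norm_sub_sq_le_of_norm_eq_one {x y : V} (hx : ‖x‖ = 1) (hy : ‖y‖ = 1) {δ : ℝ}
    (hδ : δ ≤ 2) (hxy : 2 - δ ≤ ‖x + y‖) : ‖x - y‖ ^ 2 ≤ 4 * δ := by
  have hpar := parallelogram_law_with_norm ℂ x y
  rw [hx, hy] at hpar
  nlinarith

theorem exists_norm_eq_one_lt_norm_apply {E F : Type*} [NormedAddCommGroup E] [NormedSpace ℂ E]
    [SeminormedAddCommGroup F] [NormedSpace ℂ F] {T : E →L[ℂ] F} {r : ℝ} (hr : 0 ≤ r)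
    (hT : r < ‖T‖) : ∃ ξ, ‖ξ‖ = 1 ∧ r < ‖T ξ‖ := by
  lift r to NNReal using hr
  obtain ⟨ξ, hξ, hTξ⟩ := T.exists_nnnorm_eq_one_lt_apply_of_lt_opNNNorm hT
  exact ⟨ξ, congrArg NNReal.toReal hξ, hTξ⟩

variable [CompleteSpace V]

theorem integratedForm_sum_one_add_of (ρ : G →* unitary (V →L[ℂ] V)) (s : Finset G) (v : V) :
    integratedForm ρ (∑ g ∈ s, (1 + MonoidAlgebra.of ℂ G g)) v =
      ∑ g ∈ s, (v + (ρ g : V →L[ℂ] V) v) := by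
  simp only [map_sum, map_add, map_one, integratedForm_of, sum_apply, add_apply,
    one_apply_eq_self]

theorem WeaklyContained.two_mul_card_le {ρ : G →* unitary (V →L[ℂ] V)}
    (h : WeaklyContained (1 : G →* unitary (ℂ →L[ℂ] ℂ)) ρ) (s : Finset G) :
    2 * (s.card : ℝ) ≤ ‖integratedForm ρ (∑ g ∈ s, (1 + MonoidAlgebra.of ℂ G g))‖ := by
  refine le_trans ?_ (h _)
  refine le_trans (le_of_eq ?_) (ContinuousLinearMap.unit_le_opNorm _ (1 : ℂ) norm_one.le)
  rw [integratedForm_sum_one_add_of]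
  norm_num [mul_comm]

theorem WeaklyContained.exists_almost_fixed {ρ : G →* unitary (V →L[ℂ] V)}
    (h : WeaklyContained (1 : G →* unitary (ℂ →L[ℂ] ℂ)) ρ) {s : Finset G} (hs : s.Nonempty)
    {ε : ℝ} (hε : 0 < ε) : ∃ ξ, ‖ξ‖ = 1 ∧ ∀ g ∈ s, ‖(ρ g : V →L[ℂ] V) ξ - ξ‖ ≤ ε := by
  classical
  obtain ⟨δ, hδ, hδ1, hδε⟩ : ∃ δ : ℝ, 0 < δ ∧ δ ≤ 1 ∧ 4 * δ ≤ ε ^ 2 :=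
    ⟨min 1 (ε ^ 2 / 4), by positivity, min_le_left _ _, by
      linarith [min_le_right 1 (ε ^ 2 / 4)]⟩
  have hcard : 1 ≤ (s.card : ℝ) := by exact_mod_cast hs.card_pos
  obtain ⟨ξ, hξ, hsum⟩ := exists_norm_eq_one_lt_norm_apply (r := 2 * s.card - δ) (by linarith)
    ((sub_lt_self _ hδ).trans_le (h.two_mul_card_le s))
  rw [integratedForm_sum_one_add_of] at hsum
  have hρ (g : G) : ‖(ρ g : V →L[ℂ] V) ξ‖ = 1 := (Unitary.norm_map _ _).trans hξ
  refine ⟨ξ, hξ, fun g hg => ?_⟩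
  have hrest : ‖∑ k ∈ s.erase g, (ξ + (ρ k : V →L[ℂ] V) ξ)‖ ≤ (s.erase g).card * 2 :=
    (norm_sum_le_of_le _ fun k _ => norm_add_le_of_le hξ.le (hρ k).le).trans_eq
      (by rw [Finset.sum_const, nsmul_eq_mul, one_add_one_eq_two])
  have hg_add : 2 - δ ≤ ‖ξ + (ρ g : V →L[ℂ] V) ξ‖ := by
    rw [← Finset.add_sum_erase s _ hg] at hsum
    have herase : ((s.erase g).card : ℝ) + 1 = s.card := by
      exact_mod_cast Finset.card_erase_add_one hg
    linarith [norm_add_le (ξ + (ρ g : V →L[ℂ] V) ξ) (∑ k ∈ s.erase g, (ξ + (ρ k : V →L[ℂ] V) ξ))]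
  rw [norm_sub_rev]
  exact le_of_sq_le_sq
    ((norm_sub_sq_le_of_norm_eq_one hξ (hρ g) (by linarith) hg_add).trans hδε) hε.le

end AlmostInvariant

section Mean

open Filter Topology

variable {ι G X : Type*} [Group G] [MulAction G X]

/-- A mean on `X`: a finitely additive probability measure on all subsets of `X`. -/
structure IsMean (m : Set X → ℝ) : Prop where
  nonneg (A : Set X) : 0 ≤ m A
  univ_eq_one : m Set.univ = 1
  union_of_disjoint (A B : Set X) : Disjoint A B → m (A ∪ B) = m A + m B

theorem IsMean.le_one {m : Set X → ℝ} (hm : IsMean m) (A : Set X) : m A ≤ 1 := by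
  have hcompl := hm.union_of_disjoint A Aᶜ disjoint_compl_right
  rw [Set.union_compl_self, hm.univ_eq_one] at hcompl
  linarith [hm.nonneg Aᶜ]

theorem IsMean.exists_tendsto (U : Ultrafilter ι) {μ : ι → Set X → ℝ} (hμ : ∀ i, IsMean (μ i)) :
    ∃ m, IsMean m ∧ ∀ A, Tendsto (fun i => μ i A) U (𝓝 (m A)) := by
  have hlim (A : Set X) : ∃ a, Tendsto (fun i => μ i A) U (𝓝 a) := by
    obtain ⟨a, -, ha⟩ := (isCompact_Icc (a := (0 : ℝ)) (b := 1)).ultrafilter_le_nhds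
      (U.map fun i => μ i A) <| le_principal_iff.2 <| Ultrafilter.mem_map.2 <|
        Eventually.of_forall fun i => ⟨(hμ i).nonneg A, (hμ i).le_one A⟩
    exact ⟨a, ha⟩
  choose m hm using hlim
  refine ⟨m, ⟨fun A => ge_of_tendsto' (hm A) fun i => (hμ i).nonneg A, ?_, fun A B hAB => ?_⟩, hm⟩
  · refine tendsto_nhds_unique (hm Set.univ) ?_
    simp only [(hμ _).univ_eq_one]
    exact tendsto_const_nhds
  · refine tendsto_nhds_unique (hm (A ∪ B)) ?_
    simp only [(hμ _).union_of_disjoint A B hAB]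
    exact (hm A).add (hm B)

theorem hasInvariantMean_of_almost_invariant
    (h : ∀ (s : Finset G) (ε : ℝ), 0 < ε →
      ∃ m : Set X → ℝ, IsMean m ∧ ∀ g ∈ s, ∀ A, |m ((fun x => g • x) '' A) - m A| ≤ ε) :
    HasInvariantMean G X := by
  classical
  choose μ hμ hinv using fun i : Finset G × ℕ => h i.1 (1 / (i.2 + 1)) Nat.one_div_pos_of_nat
  obtain ⟨m, hm, hlim⟩ := IsMean.exists_tendsto (Ultrafilter.of atTop) hμ
  refine ⟨m, hm.nonneg, hm.univ_eq_one, hm.union_of_disjoint, fun g A => sub_eq_zero.1 ?_⟩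
  refine tendsto_nhds_unique ((hlim _).sub (hlim A)) (Tendsto.mono_left ?_ (Ultrafilter.of_le _))
  refine squeeze_zero_norm' (a := fun i : Finset G × ℕ => 1 / ((i.2 : ℝ) + 1)) ?_
    (tendsto_one_div_add_atTop_nhds_zero_nat.comp
      (tendsto_snd.mono_left prod_atTop_atTop_eq.ge))
  filter_upwards [eventually_ge_atTop (({g}, 0) : Finset G × ℕ)] with i hi
  exact hinv i g (hi.1 (Finset.mem_singleton_self g)) A

end Mean

/-! ### Permutation representations -/

section PermRep

local notation "ℓ²(" X ")" => lp (fun _ : X => ℂ) 2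

universe u v

variable {G : Type u} [Group G] {X : Type v} [MulAction G X]

theorem permRep_apply (g : G) (f : ℓ²(X)) (x : X) :
    (permRep G X g : ℓ²(X) →L[ℂ] ℓ²(X)) f x = f (g⁻¹ • x) :=
  rfl

open Classical in
theorem permRep_single (g : G) (x : X) (a : ℂ) :
    (permRep G X g : ℓ²(X) →L[ℂ] ℓ²(X)) (lp.single 2 x a) = lp.single 2 (g • x) a := by
  ext y
  rw [permRep_apply, lp.single_apply, lp.single_apply]
  simp only [Pi.single_apply, inv_smul_eq_iff]

open Classical in
theorem norm_sq_sum_single_smul {s : Finset G} {x : X} (hs : Set.InjOn (fun g : G => g • x) s)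
    (a : G → ℂ) : ‖∑ g ∈ s, (lp.single 2 (g • x) (a g) : ℓ²(X))‖ ^ 2 = ∑ g ∈ s, ‖a g‖ ^ 2 := by
  have ha : ∀ g ∈ s, a (Function.invFunOn (fun g : G => g • x) s (g • x)) = a g :=
    fun g hg => congrArg a (hs.leftInvOn_invFunOn hg)
  have hnorm := lp.norm_sum_single (p := 2) (by norm_num)
    (fun y : X => a (Function.invFunOn (fun g : G => g • x) s y)) (s.image fun g => g • x)
  simp only [ENNReal.toReal_ofNat, Real.rpow_ofNat] at hnorm
  rw [Finset.sum_image hs, Finset.sum_image hs] at hnorm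
  rw [← Finset.sum_congr rfl fun g hg => congrArg (‖·‖ ^ 2) (ha g hg), ← hnorm]
  exact congrArg (‖·‖ ^ 2) (Finset.sum_congr rfl fun g hg => by rw [ha g hg])

open Classical in
theorem integratedForm_permRep_single (b : MonoidAlgebra ℂ G) (x : X) :
    integratedForm (permRep G X) b (lp.single 2 x 1) =
      ∑ g ∈ b.coeff.support, lp.single 2 (g • x) (b.coeff g) := by
  rw [integratedForm, MonoidAlgebra.lift_apply, Finsupp.sum, sum_apply]
  refine Finset.sum_congr rfl fun g _ => ?_
  change b.coeff g • (permRep G X g : ℓ²(X) →L[ℂ] ℓ²(X)) (lp.single 2 x 1) = _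
  rw [permRep_single, ← lp.single_smul, smul_eq_mul, mul_one]

open Classical in
theorem denseRange_integratedForm_regularRep :
    DenseRange fun b => integratedForm (regularRep G) b (lp.single 2 1 1) := by
  intro f
  refine mem_closure_of_tendsto (lp.hasSum_single (p := 2) (by norm_num) f)
    (Filter.Eventually.of_forall fun s => ⟨∑ g ∈ s, MonoidAlgebra.single g (f g), ?_⟩)
  simp only [map_sum, sum_apply]
  refine Finset.sum_congr rfl fun g _ => ?_
  rw [integratedForm, MonoidAlgebra.lift_single]
  change f g • (permRep G G g : ℓ²(G) →L[ℂ] ℓ²(G)) (lp.single 2 1 1) = _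
  rw [permRep_single, ← lp.single_smul, smul_eq_mul, smul_eq_mul, mul_one, mul_one]

theorem weaklyContained_regularRep_permRep
    (hX : ∀ F : Finset G, ∃ x : X, Set.InjOn (fun g : G => g • x) F) :
    WeaklyContained (regularRep G) (permRep G X) := by
  classical
  refine weaklyContained_of_dense_orbit denseRange_integratedForm_regularRep fun F => ?_
  obtain ⟨x, hx⟩ := hX F
  refine ⟨lp.single 2 x 1, fun b hb => ?_⟩
  rw [regularRep, integratedForm_permRep_single, integratedForm_permRep_single,
    ← sq_eq_sq₀ (norm_nonneg _) (norm_nonneg _),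
    norm_sq_sum_single_smul (mul_left_injective (1 : G)).injOn,
    norm_sq_sum_single_smul (hx.mono hb)]

theorem weaklyContained_one_permRep_of_fixed {x : X} (hx : ∀ g : G, g • x = x) :
    WeaklyContained (1 : G →* unitary (ℂ →L[ℂ] ℂ)) (permRep G X) := by
  classical
  refine weaklyContained_one_of_fixed (ξ := lp.single 2 x 1) ?_ fun g => ?_
  · rw [lp.norm_single (by norm_num), norm_one]
  · rw [permRep_single, hx]

/-- The restriction of a vector of `ℓ²(X)` to a subset of `X`, extended by zero. -/
noncomputable def ellTwoRestrict (A : Set X) (f : ℓ²(X)) : ℓ²(X) :=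
  ⟨A.indicator f, (lp.memℓp f).mono' fun _ => norm_indicator_le_norm_self _ _⟩

theorem hasSum_norm_sq_ellTwoRestrict (A : Set X) (f : ℓ²(X)) :
    HasSum (A.indicator fun x => ‖f x‖ ^ 2) (‖ellTwoRestrict A f‖ ^ 2) := by
  have h := lp.hasSum_norm (p := 2) (by norm_num) (ellTwoRestrict A f)
  simp only [ENNReal.toReal_ofNat, Real.rpow_ofNat] at h
  convert h using 2 with x
  by_cases hx : x ∈ A <;> simp [ellTwoRestrict, hx]

theorem norm_ellTwoRestrict_le (A : Set X) (f : ℓ²(X)) : ‖ellTwoRestrict A f‖ ≤ ‖f‖ :=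
  lp.norm_mono (by norm_num) fun _ => norm_indicator_le_norm_self _ _

theorem ellTwoRestrict_sub (A : Set X) (f g : ℓ²(X)) :
    ellTwoRestrict A (f - g) = ellTwoRestrict A f - ellTwoRestrict A g :=
  lp.ext (Set.indicator_sub A f g)

theorem ellTwoRestrict_univ (f : ℓ²(X)) : ellTwoRestrict Set.univ f = f :=
  lp.ext (Set.indicator_univ f)

theorem isMean_norm_sq_ellTwoRestrict {f : ℓ²(X)} (hf : ‖f‖ = 1) :
    IsMean fun A => ‖ellTwoRestrict A f‖ ^ 2 where
  nonneg A := sq_nonneg _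
  univ_eq_one := by rw [ellTwoRestrict_univ, hf, one_pow]
  union_of_disjoint A B hAB := by
    have hsum := (hasSum_norm_sq_ellTwoRestrict A f).add (hasSum_norm_sq_ellTwoRestrict B f)
    have hunion := hasSum_norm_sq_ellTwoRestrict (A ∪ B) f
    rw [Set.indicator_union_of_disjoint hAB] at hunion
    exact hunion.unique hsum

theorem ellTwoRestrict_image_smul (g : G) (A : Set X) (f : ℓ²(X)) :
    ellTwoRestrict ((fun x => g • x) '' A) f = (permRep G X g : ℓ²(X) →L[ℂ] ℓ²(X))
      (ellTwoRestrict A ((permRep G X g⁻¹ : ℓ²(X) →L[ℂ] ℓ²(X)) f)) := by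
  classical
  ext x
  have hmem : x ∈ (fun x => g • x) '' A ↔ g⁻¹ • x ∈ A := Set.mem_smul_set_iff_inv_smul_mem
  change Set.indicator _ _ x = Set.indicator A _ (g⁻¹ • x)
  rw [Set.indicator_apply, Set.indicator_apply, if_congr hmem rfl rfl, permRep_apply, inv_inv,
    smul_inv_smul]

theorem abs_norm_sq_ellTwoRestrict_sub_le (A : Set X) {f g : ℓ²(X)}
    (hf : ‖f‖ = 1) (hg : ‖g‖ = 1) :
    |‖ellTwoRestrict A f‖ ^ 2 - ‖ellTwoRestrict A g‖ ^ 2| ≤ 2 * ‖f - g‖ := by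
  have hdiff : |‖ellTwoRestrict A f‖ - ‖ellTwoRestrict A g‖| ≤ ‖f - g‖ :=
    (abs_norm_sub_norm_le _ _).trans (ellTwoRestrict_sub A f g ▸ norm_ellTwoRestrict_le A (f - g))
  have hsum : ‖ellTwoRestrict A f‖ + ‖ellTwoRestrict A g‖ ≤ 2 := by
    linarith [norm_ellTwoRestrict_le A f, norm_ellTwoRestrict_le A g]
  rw [sq_sub_sq, abs_mul, abs_of_nonneg (by positivity)]
  exact mul_le_mul hsum hdiff (abs_nonneg _) zero_le_two

theorem WeaklyContained.hasInvariantMean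
    (h : WeaklyContained (1 : G →* unitary (ℂ →L[ℂ] ℂ)) (permRep G X)) : HasInvariantMean G X := by
  classical
  refine hasInvariantMean_of_almost_invariant fun s ε hε => ?_
  obtain ⟨ξ, hξ, hfix⟩ := h.exists_almost_fixed
    (s := insert 1 (s.image (·⁻¹))) (Finset.insert_nonempty _ _) (half_pos hε)
  refine ⟨_, isMean_norm_sq_ellTwoRestrict hξ, fun g hg A => ?_⟩
  have hg_fix := hfix g⁻¹ (Finset.mem_insert_of_mem (Finset.mem_image_of_mem _ hg))
  rw [ellTwoRestrict_image_smul, Unitary.norm_map]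
  linarith [abs_norm_sq_ellTwoRestrict_sub_le A ((Unitary.norm_map _ _).trans hξ) hξ
    (f := (permRep G X g⁻¹ : ℓ²(X) →L[ℂ] ℓ²(X)) ξ)]

end PermRep

/-! ### Exotic quasi-regular representations -/

section Exotic

universe u

variable {G : Type u} [Group G]

theorem weaklyContained_universalRep (π : UnitaryRep G) :
    WeaklyContained π.hom (universalRep G) := by
  classical
  let T : π.space →ₗᵢ[ℂ] lp (fun π : UnitaryRep G => π.space) 2 :=
    ⟨lp.lsingle (𝕜 := ℂ) (E := fun π : UnitaryRep G => π.space) 2 π,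
      fun v => lp.norm_single (by norm_num) π v⟩
  refine .of_linearIsometry T fun g v => ?_
  ext κ
  change lp.single 2 π _ κ = (κ.hom g : κ.space →L[ℂ] κ.space) (lp.single 2 π v κ)
  obtain rfl | hκ := eq_or_ne κ π
  · rw [lp.single_apply_self, lp.single_apply_self]
  · rw [lp.single_apply_ne _ _ _ hκ, lp.single_apply_ne _ _ _ hκ, map_zero]

theorem weaklyContained_one_universalRep :
    WeaklyContained (1 : G →* unitary (ℂ →L[ℂ] ℂ)) (universalRep G) :=
  (weaklyContained_one_permRep_of_fixed (x := PUnit.unit.{u + 1}) fun _ => rfl).trans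
    (weaklyContained_universalRep ⟨lp (fun _ : PUnit.{u + 1} => ℂ) 2, permRep G PUnit.{u + 1}⟩)

theorem weaklyContained_one_quasiRegularRep_comp_subtype (H : Subgroup G) :
    WeaklyContained (1 : H →* unitary (ℂ →L[ℂ] ℂ)) ((quasiRegularRep H).comp H.subtype) :=
  weaklyContained_one_permRep_of_fixed (G := H) (x := ((1 : G) : G ⧸ H)) fun h => by
    change (((h : G) * 1 : G) : G ⧸ H) = _
    rw [QuotientGroup.eq]
    simp

theorem IsUnconfined.exists_injOn {H : Subgroup G} (hH : IsUnconfined H) (F : Finset G) :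
    ∃ x : G ⧸ H, Set.InjOn (fun g : G => g • x) F := by
  classical
  obtain ⟨γ, hγ⟩ := hH (((F ×ˢ F).image fun p => p.1⁻¹ * p.2).erase 1) (by simp)
  refine ⟨(γ : G ⧸ H), fun a ha b hb hab => ?_⟩
  have hmem : (a * γ)⁻¹ * (b * γ) ∈ H := QuotientGroup.eq.1 hab
  have hnotMem := hγ _ hmem
  rw [show γ * ((a * γ)⁻¹ * (b * γ)) * γ⁻¹ = a⁻¹ * b by group, Finset.mem_erase,
    not_and'] at hnotMem
  have hone := hnotMem (Finset.mem_image.2 ⟨(a, b), Finset.mem_product.2 ⟨ha, hb⟩, rfl⟩)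
  exact inv_mul_eq_one.1 (not_not.1 hone)

theorem IsUnconfined.isExotic {H : Subgroup G} (hH : IsUnconfined H)
    (hamen : ¬ IsAmenableGroup H) (hco : ¬ IsCoamenable H) : IsExotic (quasiRegularRep H) := by
  obtain ⟨p, hp, hp_surj⟩ := (weaklyContained_universalRep
    ⟨lp (fun _ : G ⧸ H => ℂ) 2, quasiRegularRep H⟩).exists_surjective
  obtain ⟨q, hq, hq_surj⟩ :=
    (weaklyContained_regularRep_permRep hH.exists_injOn).exists_surjective
  refine ⟨p, q, hp, hq, hp_surj, hq_surj, fun hp_bij => hco ?_, fun hq_bij => hamen ?_⟩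
  · exact (weaklyContained_one_universalRep.trans
      (weaklyContained_of_injective hp hp_bij.injective)).hasInvariantMean
  · have hone : WeaklyContained (1 : H →* unitary (ℂ →L[ℂ] ℂ)) (permRep H G) :=
      (weaklyContained_one_quasiRegularRep_comp_subtype H).trans
        ((weaklyContained_of_injective hq hq_bij.injective).comp H.subtype)
    exact isAmenableGroup_of_hasInvariantMean hone.hasInvariantMean

end Exotic

theorem mainTheorem2 {L Z : Type*} [Group L] [Group Z]
    (hL : ¬ IsAmenableGroup L) (hLfree : HasNoNonabelianFreeSubgroup L) [Nontrivial Z] :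
    ¬ IsAmenableGroup (lampSubgroup L Z) ∧
    ¬ IsCoamenable (lampSubgroup L Z) ∧
    (Infinite Z →
      IsUnconfined (lampSubgroup L Z) ∧ IsExotic (quasiRegularRep (lampSubgroup L Z))) ∧
    (HasNoNonabelianFreeSubgroup Z → HasNoNonabelianFreeSubgroup (restrictedWreath L Z)) :=
  ⟨not_isAmenableGroup_lampSubgroup hL, not_isCoamenable_lampSubgroup hL,
    fun _ => ⟨isUnconfined_lampSubgroup, isUnconfined_lampSubgroup.isExotic
      (not_isAmenableGroup_lampSubgroup hL) (not_isCoamenable_lampSubgroup hL)⟩,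
    hasNoNonabelianFreeSubgroup_restrictedWreath hLfree⟩
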